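/- Let $\lambda,\mu,\alpha,\beta>0$. The unreliable $M/M/1$ queue is the continuous-time Markov chain on $\mathbb{N}\times\{Up,Down\}$, $\mathbb{N}=\{0,1,2,\dots\}$ (number of customers, status of the server), whose only transitions are $(k,\sigma)\to(k+1,\sigma)$ with intensity $\lambda$ (for both statuses $\sigma$), $(k,Up)\to(k-1,Up)$ with intensity $\mu$ for $k\ge1$, $(k,Up)\to(k,Down)$ with intensity $\alpha$ and $(k,Down)\to(k,Up)$ with intensity $\beta$. Put $$s_1=(\mu-\lambda-\beta-\alpha)^2+4\alpha\mu,\qquad \gamma_1=\frac{2\lambda}{\lambda+\beta+\mu+\alpha-\sqrt{s_1}},\qquad L=\lambda+\beta-\mu-\alpha+\sqrt{s_1},\qquad G=\frac{L}{2}+\frac{2\alpha\beta}{L}.$$ Fix $C\ge\lambda+\mu+\alpha+\beta$. The free process is the discrete-time Markov chain on $\mathbb{Z}\times\{Up,Down\}$ with transition probabilities $K^\infty((x,\sigma),(x+1,\sigma))=\lambda/C$, $K^\infty((x,Up),(x-1,Up))=\mu/C$, $K^\infty((x,Up),(x,Down))=\alpha/C$, $K^\infty((x,Down),(x,Up))=\beta/C$,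 $K^\infty((x,Up),(x,Up))=1-(\lambda+\mu+\alpha)/C$, $K^\infty((x,Down),(x,Down))=1-(\lambda+\beta)/C$. Let $h(x,Up)=\gamma_1^{-x}$ and $h(x,Down)=\gamma_1^{-x}\cdot 2\beta/L$ be its harmonic function; the twisted free process is the Markov chain with kernel $\mathcal{K}(z,z')=K^\infty(z,z')h(z')/h(z)$. Let $\tilde d^{(1)}$ be the stationary horizontal drift of the twisted free process, i.e. the mean one-step increment of its first coordinate when its status has the stationary distribution of the status chain. For $\sigma\in\{Up,Down\}$ let $\mathcal{H}(0,\sigma)$ be the probability that the twisted free process started at $(0,\sigma)$ satisfies $x\ge1$ at all times $n\ge1$, and for a stationary distribution $\pi$ of the queue put $$\eta^{(1)}=\sum_{\sigma\in\{Up,Down\}}\pi(0,\sigma)\,h(0,\sigma)\,\mathcal{H}(0,\sigma).$$ Assume $\lambda<\frac{\beta}{\alpha+\beta}\mu$. Then the queue has a unique stationary distribution $\pi$, $\gamma_1\in(0,1)$, $$\tilde d^{(1)}=\frac1C\left(\frac{\lambda+\beta+\mu+\alpha-\sqrt{s_1}}{2}-\frac{1}{G}\,\lambda\mu\,\frac{\lambda+\beta-\mu-\alpha+\sqrt{s_1}}{\lambda+\beta+\mu+\alpha-\sqrt{s_1}}\right),$$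 and, as $k\to\infty$ (where $n_k\sim m_k$ means $n_k/m_k\to1$), $$\pi(k,Up)\sim C^{(1)}(Up)\,\gamma_1^k,\qquad \pi(k,Down)\sim C^{(1)}(Down)\,\gamma_1^k,$$ where $$C^{(1)}(Up)=\frac{\eta^{(1)}}{\tilde d^{(1)}}\,\frac1G\,\frac{\lambda+\beta-\mu-\alpha+\sqrt{s_1}}{2}\ne0,\qquad C^{(1)}(Down)=\frac{\eta^{(1)}}{\tilde d^{(1)}}\,\frac{\alpha}{G}\ne0 .$$ -/

import Mathlib

open MeasureTheory ProbabilityTheory Filter Topology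

noncomputable section

namespace UnreliableQueue

/-- The status of the server. -/
inductive Status where
  | Up : Status
  | Down : Status
deriving DecidableEq

instance : Fintype Status := ⟨{Status.Up, Status.Down}, fun s => by cases s <;> decide⟩

instance : MeasurableSpace Status := ⊤

instance : DiscreteMeasurableSpace Status := ⟨fun _ => trivial⟩

/-- The parameters of the unreliable `M/M/1` queue: arrival rate `lam`, service rate `mu`,
breakdown rate `alpha`, repair rate `beta`, all positive. -/
structure Model where
  lam : ℝ
  mu : ℝ
  alpha : ℝ
  beta : ℝ
  lam_pos : 0 < lam
  mu_pos : 0 < mu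
  alpha_pos : 0 < alpha
  beta_pos : 0 < beta

namespace Model

variable (M : Model)

/-! ### The queue and its stationary distribution -/

/-- The transition intensity from state `i` to a different state `j`. A state `(x, s)` is a
number `x` of customers together with the status `s` of the server. -/
def rate (i j : ℕ × Status) : ℝ :=
  if j.1 = i.1 + 1 ∧ j.2 = i.2 then M.lam
  else if j.1 + 1 = i.1 ∧ i.2 = Status.Up ∧ j.2 = Status.Up then M.mu
  else if j.1 = i.1 ∧ i.2 = Status.Up ∧ j.2 = Status.Down then M.alpha
  else if j.1 = i.1 ∧ i.2 = Status.Down ∧ j.2 = Status.Up then M.beta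
  else 0

/-- The generator of the continuous-time Markov chain (only finitely many rates out of a state
are nonzero, so the sum is a finite one). -/
def generator (i j : ℕ × Status) : ℝ :=
  M.rate i j - if i = j then ∑' k, M.rate i k else 0

/-- `π` is a stationary distribution of the queue: a probability vector with `π Q = 0`. -/
structure IsStationary (π : ℕ × Status → ℝ) : Prop where
  nonneg : ∀ i, 0 ≤ π i
  total : HasSum π 1
  balance : ∀ j, HasSum (fun i => π i * M.generator i j) 0

/-- The stability condition. -/
def Stable : Prop := M.lam < M.beta / (M.alpha + M.beta) * M.mu

/-! ### The explicit constants -/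

/-- `s₁ = (μ - λ - β - α)² + 4αμ`. -/
def s₁ : ℝ := (M.mu - M.lam - M.beta - M.alpha) ^ 2 + 4 * M.alpha * M.mu

/-- `γ₁ = 2λ / (λ + β + μ + α - √s₁)`. -/
def γ₁ : ℝ := 2 * M.lam / (M.lam + M.beta + M.mu + M.alpha - √M.s₁)

/-- The constant `G`. -/
def G : ℝ :=
  (M.lam + M.beta - M.mu - M.alpha + √M.s₁) / 2 +
    2 * M.alpha * M.beta / (M.lam + M.beta - M.mu - M.alpha + √M.s₁)

/-! ### The free process and the twisted free process -/

/-- `freeStep C s z s'`: the one-step probability that the uniformized free process (with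
uniformization constant `C`) moves from `(0, s)` to `(z, s')`. -/
def freeStep (C : ℝ) (s : Status) (z : ℤ) (s' : Status) : ℝ :=
  if z = 1 then (if s' = s then M.lam / C else 0)
  else if z = -1 then (if s = Status.Up ∧ s' = Status.Up then M.mu / C else 0)
  else if z = 0 then
    match s, s' with
    | Status.Up, Status.Down => M.alpha / C
    | Status.Down, Status.Up => M.beta / C
    | Status.Down, Status.Down => 1 - (M.lam + M.beta) / C
    | Status.Up, Status.Up => 1 - (M.alpha + M.mu + M.lam) / C
  else 0

/-- The kernel of the free process on `ℤ × {Up, Down}`. -/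
def freeKernel (C : ℝ) (x y : ℤ × Status) : ℝ := M.freeStep C x.2 (y.1 - x.1) y.2

/-- The harmonic function of the free process. -/
def h (x : ℤ × Status) : ℝ :=
  match x.2 with
  | Status.Up => (1 / M.γ₁) ^ x.1
  | Status.Down =>
    (1 / M.γ₁) ^ x.1 * (2 * M.beta / (M.lam + M.beta - M.mu - M.alpha + √M.s₁))

/-- The kernel of the twisted free process, i.e. the `h`-transform of the free kernel. -/
def twisted (C : ℝ) (x y : ℤ × Status) : ℝ := M.freeKernel C x y * M.h y / M.h x

theorem s₁_eq : M.s₁ = (M.mu + M.lam + M.beta + M.alpha) ^ 2 - 4 * M.mu * (M.lam + M.beta) := by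
  unfold s₁; ring

theorem sq_sqrt_s₁ : √M.s₁ ^ 2 = M.s₁ := by
  have := M.alpha_pos
  have := M.mu_pos
  exact Real.sq_sqrt (by unfold s₁; positivity)

theorem denom_pos : 0 < M.lam + M.beta + M.mu + M.alpha - √M.s₁ := by
  have h1 := M.lam_pos
  have h2 := M.mu_pos
  have h3 := M.alpha_pos
  have h4 := M.beta_pos
  have h5 := M.sq_sqrt_s₁
  have h6 := M.s₁_eq
  have : 0 < M.mu * (M.lam + M.beta) := by positivity
  have h7 : √M.s₁ < M.lam + M.beta + M.mu + M.alpha :=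
    lt_of_pow_lt_pow_left₀ 2 (by positivity) (by nlinarith)
  linarith

theorem ell_pos : 0 < M.lam + M.beta - M.mu - M.alpha + √M.s₁ := by
  have h1 := M.lam_pos
  have h2 := M.mu_pos
  have h3 := M.alpha_pos
  have h4 := M.beta_pos
  have h5 := M.sq_sqrt_s₁
  have h6 : M.s₁ = (M.lam + M.beta - M.mu - M.alpha) ^ 2 + 4 * (M.alpha * (M.lam + M.beta)) := by
    unfold s₁; ring
  have : 0 < M.alpha * (M.lam + M.beta) := by positivity
  have h7 : M.mu + M.alpha - M.lam - M.beta < √M.s₁ :=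
    lt_of_pow_lt_pow_left₀ 2 (Real.sqrt_nonneg _) (by nlinarith)
  linarith

theorem γ₁_pos : 0 < M.γ₁ := by
  have h1 := M.lam_pos
  have h2 := M.denom_pos
  unfold γ₁; positivity

theorem h_pos (x : ℤ × Status) : 0 < M.h x := by
  have h1 := M.γ₁_pos
  have h2 := M.ell_pos
  have h3 := M.beta_pos
  rcases x with ⟨x, s⟩
  cases s <;> simp only [h] <;> positivity

theorem twisted_nonneg {C : ℝ} (hC : M.lam + M.mu + M.alpha + M.beta ≤ C) (x y : ℤ × Status) :
    0 ≤ M.twisted C x y := by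
  have h1 := M.lam_pos
  have h2 := M.mu_pos
  have h3 := M.alpha_pos
  have h4 := M.beta_pos
  have hC0 : 0 < C := by linarith
  have e1 : 0 ≤ 1 - (M.lam + M.beta) / C := by
    rw [sub_nonneg, div_le_one hC0]; linarith
  have e2 : 0 ≤ 1 - (M.alpha + M.mu + M.lam) / C := by
    rw [sub_nonneg, div_le_one hC0]; linarith
  have hk : 0 ≤ M.freeKernel C x y := by
    unfold freeKernel freeStep
    split_ifs <;> first | positivity | skip
    split <;> first | assumption | positivity
  have := M.h_pos x
  have := M.h_pos y
  unfold twisted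
  positivity

/-- The rows of the twisted kernel sum to `1` (harmonicity of `h`). -/
theorem twisted_hasSum {C : ℝ} (hC : M.lam + M.mu + M.alpha + M.beta ≤ C) (x : ℤ × Status) :
    HasSum (M.twisted C x) 1 := by
  have p1 := M.lam_pos
  have p2 := M.mu_pos
  have p3 := M.alpha_pos
  have p4 := M.beta_pos
  have hC0 : 0 < C := by linarith
  have hT := M.denom_pos
  have hL := M.ell_pos
  have hsq := M.sq_sqrt_s₁.trans M.s₁_eq
  have hg := M.γ₁_pos
  obtain ⟨x, s⟩ := x
  have key : ∑ y ∈ ({x - 1, x, x + 1} : Finset ℤ) ×ˢ (Finset.univ : Finset Status),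
      M.twisted C (x, s) y = 1 := by
    have n1 : x - 1 ∉ ({x, x + 1} : Finset ℤ) := by
      simp only [Finset.mem_insert, Finset.mem_singleton]; omega
    have n2 : x ∉ ({x + 1} : Finset ℤ) := by
      simp only [Finset.mem_singleton]; omega
    have hu : (Finset.univ : Finset Status) = {Status.Up, Status.Down} := rfl
    have hg0 : (1 / M.γ₁) ≠ 0 := by positivity
    have hgx : (1 / M.γ₁) ^ x ≠ 0 := zpow_ne_zero _ hg0
    have hinv : 1 / M.γ₁ = (M.lam + M.beta + M.mu + M.alpha - √M.s₁) / (2 * M.lam) := by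
      rw [γ₁, one_div_div]
    rw [Finset.sum_product, Finset.sum_insert n1, Finset.sum_insert n2, Finset.sum_singleton, hu]
    cases s <;>
    · simp [twisted, freeKernel, freeStep, h, zpow_add₀, zpow_sub₀, hg.ne', -one_div, -inv_zpow']
      generalize (1 / M.γ₁) ^ x = Z at *
      rw [hinv]
      generalize √M.s₁ = r at *
      have hT' := hT.ne'
      have hL' := hL.ne'
      field_simp
      first
        | ring1
        | linear_combination (r + M.lam - M.beta - M.mu - M.alpha) * hsq
  rw [← key]
  refine hasSum_sum_of_ne_finset_zero ?_
  rintro ⟨z, t⟩ hz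
  have hz' : z ≠ x - 1 ∧ z ≠ x ∧ z ≠ x + 1 := by simpa using hz
  have a1 : z - x ≠ 1 := by omega
  have a2 : z - x ≠ -1 := by omega
  have a3 : z - x ≠ 0 := by omega
  simp [twisted, freeKernel, freeStep, a1, a2, a3]

/-- The law of one step of the twisted free process from `x`. -/
def twistedRow (C : ℝ) (x : ℤ × Status) : Measure (ℤ × Status) :=
  Measure.sum fun y => ENNReal.ofReal (M.twisted C x y) • Measure.dirac y

theorem twistedRow_univ {C : ℝ} (hC : M.lam + M.mu + M.alpha + M.beta ≤ C) (x : ℤ × Status) :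
    M.twistedRow C x Set.univ = 1 := by
  unfold twistedRow
  rw [Measure.sum_apply _ MeasurableSet.univ]
  simp only [Measure.smul_apply, measure_univ, smul_eq_mul, mul_one]
  rw [← ENNReal.ofReal_tsum_of_nonneg (M.twisted_nonneg hC x) (M.twisted_hasSum hC x).summable,
    (M.twisted_hasSum hC x).tsum_eq, ENNReal.ofReal_one]

/-- The twisted free process at time `n + 1`, given its path up to time `n`. -/
def twistedStep (C : ℝ) (n : ℕ) :
    Kernel ((i : Finset.Iic n) → (fun _ : ℕ => ℤ × Status) i) (ℤ × Status) :=
  (Kernel.ofFunOfCountable (M.twistedRow C)).comap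
    (fun ω => ω ⟨n, Finset.mem_Iic.2 le_rfl⟩) (measurable_pi_apply _)

theorem twistedStep_markov {C : ℝ} (hC : M.lam + M.mu + M.alpha + M.beta ≤ C) (n : ℕ) :
    IsMarkovKernel (M.twistedStep C n) :=
  ⟨fun _ => ⟨M.twistedRow_univ hC _⟩⟩

/-- The law, on the space of trajectories, of the twisted free process started at `x`. -/
def twistedLaw (C : ℝ) (hC : M.lam + M.mu + M.alpha + M.beta ≤ C) (x : ℤ × Status) :
    Measure (ℕ → ℤ × Status) :=
  haveI := M.twistedStep_markov hC
  Kernel.traj (X := fun _ => ℤ × Status) (M.twistedStep C) 0 (fun _ => x)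

/-! ### The constant `η` and the drift -/

/-- The boundary `△ = {(0, Up), (0, Down)}`. -/
def boundary : Set (ℤ × Status) := {x | x.1 = 0}

/-- The state space `E = ℕ × {Up, Down}` of the queue inside the one of the free process. -/
def states : Set (ℤ × Status) := {x | 0 ≤ x.1}

/-- The probability that the twisted free process started at `x` never hits, at a time `n ≥ 1`,
the complement of `E \ △`. -/
def escape (C : ℝ) (hC : M.lam + M.mu + M.alpha + M.beta ≤ C) (x : ℤ × Status) : ℝ :=
  (M.twistedLaw C hC x).real {ω | ∀ n : ℕ, 1 ≤ n → ω n ∉ (states \ boundary)ᶜ}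

/-- The constant `η`, a sum over the two boundary states `(0, s)`. -/
def η (C : ℝ) (hC : M.lam + M.mu + M.alpha + M.beta ≤ C) (π : ℕ × Status → ℝ) : ℝ :=
  ∑ s : Status, π (0, s) * M.h (0, s) * M.escape C hC (0, s)

/-- The transition matrix of the Markovian part of the twisted free process. -/
def K₂ (C : ℝ) (s s' : Status) : ℝ := ∑' z : ℤ, M.twisted C (0, s) (z, s')

/-- The stationary distribution of the two-state chain `K₂`. -/
def φ (C : ℝ) : Status → ℝ
  | Status.Up => M.K₂ C Status.Down Status.Up /
      (M.K₂ C Status.Down Status.Up + M.K₂ C Status.Up Status.Down)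
  | Status.Down => M.K₂ C Status.Up Status.Down /
      (M.K₂ C Status.Down Status.Up + M.K₂ C Status.Up Status.Down)

/-- The stationary horizontal drift of the twisted free process: the mean displacement in one
step of the first coordinate, the second one having law `φ`. (The sums are finite, as a step
changes the first coordinate by at most `1`.) -/
def drift (C : ℝ) : ℝ :=
  ∑ s : Status, M.φ C s * ∑ s' : Status, ∑' z : ℤ, (z : ℝ) * M.twisted C (0, s) (z, s')

/-- The constant in front of `γ₁ ^ k` in the asymptotics of `π (k, s)`. -/
def asympConst (C : ℝ) (hC : M.lam + M.mu + M.alpha + M.beta ≤ C) (π : ℕ × Status → ℝ) :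
    Status → ℝ
  | Status.Up => M.η C hC π / M.drift C * (1 / M.G) *
      ((M.lam + M.beta - M.mu - M.alpha + √M.s₁) / 2)
  | Status.Down => M.η C hC π / M.drift C * (M.alpha / M.G)

end Model

end UnreliableQueue

end

noncomputable section

namespace UnreliableQueue

namespace Model

variable (M : Model)

/-! ### A rational parametrization of the constants -/

/-! Write τ = `tau`, ℓ = `ell`. Then β = τ + ℓ − λ and α = (μ − τ)ℓ/τ, so every constant is rational
in λ, μ, τ, ℓ and the algebra reduces to `field_simp; ring`.

The stationary law is explicit. Flow balance across the cut between levels k and k + 1, with the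
balance at the Down states, determines everything from π(0, Up). Hence π is a multiple of
`baseMeasure`, a combination of γ₁^k and γ₂^k with γ₂ < γ₁ (`eq_smul_baseMeasure`). Stability gives
λ < τ, hence γ₁ < 1 and summability. Geometric decay is then immediate; what remains is to match the
leading coefficient with η and the drift.

For η one needs escape probabilities. The free process can leave {x ≥ 1} only at (0, Up), where h =
1, so the h-transform multiplies the probability of each exit path from x by 1/h(x) (`survival_eq`).
Under stability a linear Lyapunov function bounds the mean exit time of the free process, which
therefore exits almost surely; so the twisted process started at x ≥ 1 survives forever with
probability 1 − 1/h(x). One more step gives the escape probabilities from level 0. Both η and the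
drift then contain the factor τ − λ, which cancels in their quotient and leaves the coefficient of
γ₁^k. -/

/-- Half of the denominator of `γ₁`; the smaller root of
`t² - (λ + β + μ + α) t + μ (λ + β)`. -/
def tau : ℝ := (M.lam + M.beta + M.mu + M.alpha - √M.s₁) / 2

/-- Half of the constant `L`. -/
def ell : ℝ := (M.lam + M.beta - M.mu - M.alpha + √M.s₁) / 2

theorem tau_pos : 0 < M.tau := half_pos M.denom_pos

theorem ell_half_pos : 0 < M.ell := half_pos M.ell_pos

theorem denom_eq : M.lam + M.beta + M.mu + M.alpha - √M.s₁ = 2 * M.tau := by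
  unfold tau; ring

theorem two_ell_eq : M.lam + M.beta - M.mu - M.alpha + √M.s₁ = 2 * M.ell := by
  unfold ell; ring

theorem beta_eq : M.beta = M.tau + M.ell - M.lam := by
  unfold tau ell; ring

/-- This is the quadratic equation of τ, rewritten with ℓ = λ + β − τ. -/
theorem mu_sub_tau_mul_ell : (M.mu - M.tau) * M.ell = M.alpha * M.tau := by
  have h := M.sq_sqrt_s₁.trans M.s₁_eq
  unfold tau ell
  linear_combination h / 4

theorem alpha_eq : M.alpha = (M.mu - M.tau) * M.ell / M.tau := by
  rw [M.mu_sub_tau_mul_ell, mul_div_cancel_right₀ _ M.tau_pos.ne']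

theorem tau_lt_mu : M.tau < M.mu := by
  have h := M.mu_sub_tau_mul_ell
  have h' := mul_pos M.alpha_pos M.tau_pos
  rw [← h] at h'
  exact sub_pos.1 (pos_of_mul_pos_left h' M.ell_half_pos.le)

theorem γ₁_eq : M.γ₁ = M.lam / M.tau := by
  rw [γ₁, denom_eq, mul_div_mul_left _ _ two_ne_zero]

theorem G_eq : M.G = M.ell + M.alpha * M.beta / M.ell := by
  rw [G, two_ell_eq, mul_div_cancel_left₀ _ two_ne_zero, mul_assoc,
    mul_div_mul_left _ _ two_ne_zero]

theorem h_up (x : ℤ) : M.h (x, Status.Up) = (M.tau / M.lam) ^ x := by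
  simp only [h, γ₁_eq, one_div_div]

theorem h_down (x : ℤ) : M.h (x, Status.Down) = (M.tau / M.lam) ^ x * (M.beta / M.ell) := by
  simp only [h, γ₁_eq, one_div_div, two_ell_eq]
  rw [mul_div_mul_left _ _ two_ne_zero]

variable {M} in
theorem Stable.mul_lt (hM : M.Stable) : M.lam * (M.alpha + M.beta) < M.mu * M.beta := by
  have h : M.lam < M.beta / (M.alpha + M.beta) * M.mu := hM
  have := add_pos M.alpha_pos M.beta_pos
  rw [div_mul_eq_mul_div, lt_div_iff₀ this] at h
  linarith

variable {M} in
theorem Stable.lam_lt_tau (hM : M.Stable) : M.lam < M.tau := by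
  have h1 := hM.mul_lt
  have h2 := M.mu_sub_tau_mul_ell
  have h3 := M.tau_lt_mu
  have h4 := M.beta_eq
  have h5 := M.beta_pos
  have h6 := M.alpha_pos
  have h7 := M.ell_half_pos
  have h8 := M.tau_pos
  by_contra! hle
  -- The quadratic with root τ takes at λ the value μβ − λ(α + β) = (τ − λ)(α + β + μ − τ). The left
  -- side is positive by stability, and the last factor is positive.
  nlinarith [mul_nonneg (sub_nonneg.2 hle) h6.le, mul_nonneg (sub_nonneg.2 hle) h5.le,
    mul_nonneg (sub_nonneg.2 hle) (sub_nonneg.2 h3.le)]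

variable {M} in
theorem Stable.γ₁_lt_one (hM : M.Stable) : M.γ₁ < 1 := by
  rw [γ₁_eq, div_lt_one M.tau_pos]; exact hM.lam_lt_tau

/-- The smaller eigenvalue of the recurrence satisfied by stationary measures. -/
def γ₂ : ℝ := M.lam * M.tau / (M.mu * (M.tau + M.ell))

theorem γ₂_pos : 0 < M.γ₂ :=
  div_pos (mul_pos M.lam_pos M.tau_pos)
    (mul_pos M.mu_pos (add_pos M.tau_pos M.ell_half_pos))

theorem γ₂_lt_γ₁ : M.γ₂ < M.γ₁ := by
  have h1 := M.tau_pos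
  have h2 := M.ell_half_pos
  have h3 := M.tau_lt_mu
  have h4 := M.lam_pos
  have h5 := M.mu_pos
  rw [γ₁_eq, γ₂, div_lt_div_iff₀ (by positivity) h1, mul_assoc]
  refine mul_lt_mul_of_pos_left ?_ h4
  nlinarith

/-! ### Stationary distributions -/

theorem sum_status (f : Status → ℝ) : ∑ s, f s = f Status.Up + f Status.Down := by
  have hu : (Finset.univ : Finset Status) = {Status.Up, Status.Down} := rfl
  rw [hu, Finset.sum_pair (by decide)]

theorem tsum_rate_zero_up : ∑' k, M.rate (0, Status.Up) k = M.lam + M.alpha := by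
  rw [tsum_eq_sum (s := {0, 1} ×ˢ Finset.univ)]
  · rw [Finset.sum_product, Finset.sum_pair (by decide)]
    simp only [sum_status]
    simp [rate]
    ring
  · rintro ⟨z, t⟩ hz
    have hz' : z ≠ 0 ∧ z ≠ 1 := by simpa using hz
    simp [rate, hz'.1, hz'.2]

theorem tsum_rate_succ_up (x : ℕ) :
    ∑' k, M.rate (x + 1, Status.Up) k = M.lam + M.mu + M.alpha := by
  rw [tsum_eq_sum (s := {x, x + 1, x + 2} ×ˢ Finset.univ)]
  · rw [Finset.sum_product, Finset.sum_insert (by simp), Finset.sum_insert (by simp),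
      Finset.sum_singleton]
    have : x ≠ x + 1 + 1 := by omega
    simp only [sum_status]
    simp [rate, this]
    ring
  · rintro ⟨z, t⟩ hz
    have hz' : z ≠ x ∧ z ≠ x + 1 ∧ z ≠ x + 2 := by simpa using hz
    have : z ≠ x + 1 + 1 := hz'.2.2
    simp [rate, hz'.1, hz'.2.1, this]

theorem tsum_rate_down (x : ℕ) :
    ∑' k, M.rate (x, Status.Down) k = M.lam + M.beta := by
  rw [tsum_eq_sum (s := {x, x + 1} ×ˢ Finset.univ)]
  · rw [Finset.sum_product, Finset.sum_pair (by simp)]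
    simp only [sum_status]
    simp [rate]
    ring
  · rintro ⟨z, t⟩ hz
    have hz' : z ≠ x ∧ z ≠ x + 1 := by simpa using hz
    simp [rate, hz'.1, hz'.2]

/-- Each column of the generator is supported on neighbouring levels, so its sum is inflow minus
outflow. Level 0 is separate, having no departures and no arrivals from below. -/
theorem hasSum_column_zero_up (p : ℕ × Status → ℝ) :
    HasSum (fun i => p i * M.generator i (0, Status.Up))
      (M.mu * p (1, Status.Up) + M.beta * p (0, Status.Down)
        - (M.lam + M.alpha) * p (0, Status.Up)) := by
  have key : ∑ i ∈ ({0, 1} : Finset ℕ) ×ˢ Finset.univ, p i * M.generator i (0, Status.Up) =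
      M.mu * p (1, Status.Up) + M.beta * p (0, Status.Down)
        - (M.lam + M.alpha) * p (0, Status.Up) := by
    rw [Finset.sum_product, Finset.sum_pair (by decide)]
    simp only [sum_status, generator, tsum_rate_zero_up]
    simp [rate]
    ring
  rw [← key]
  refine hasSum_sum_of_ne_finset_zero ?_
  rintro ⟨z, t⟩ hz
  have hz' : z ≠ 0 ∧ z ≠ 1 := by simpa using hz
  simp [generator, rate, hz'.1, hz'.1.symm, hz'.2.symm]

theorem hasSum_column_succ_up (p : ℕ × Status → ℝ) (x : ℕ) :
    HasSum (fun i => p i * M.generator i (x + 1, Status.Up))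
      (M.lam * p (x, Status.Up) + M.mu * p (x + 2, Status.Up)
        + M.beta * p (x + 1, Status.Down)
        - (M.lam + M.mu + M.alpha) * p (x + 1, Status.Up)) := by
  have key : ∑ i ∈ ({x, x + 1, x + 2} : Finset ℕ) ×ˢ Finset.univ,
      p i * M.generator i (x + 1, Status.Up) =
      M.lam * p (x, Status.Up) + M.mu * p (x + 2, Status.Up)
        + M.beta * p (x + 1, Status.Down)
        - (M.lam + M.mu + M.alpha) * p (x + 1, Status.Up) := by
    rw [Finset.sum_product, Finset.sum_insert (by simp), Finset.sum_insert (by simp),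
      Finset.sum_singleton]
    simp only [sum_status, generator, tsum_rate_succ_up]
    simp [rate]
    ring
  rw [← key]
  refine hasSum_sum_of_ne_finset_zero ?_
  rintro ⟨z, t⟩ hz
  have hz' : z ≠ x ∧ z ≠ x + 1 ∧ z ≠ x + 2 := by simpa using hz
  have : x + 1 + 1 ≠ z := hz'.2.2.symm
  simp [generator, rate, hz'.1.symm, hz'.2.1, hz'.2.1.symm, this]

theorem hasSum_column_zero_down (p : ℕ × Status → ℝ) :
    HasSum (fun i => p i * M.generator i (0, Status.Down))
      (M.alpha * p (0, Status.Up) - (M.lam + M.beta) * p (0, Status.Down)) := by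
  have key : ∑ i ∈ ({0} : Finset ℕ) ×ˢ Finset.univ, p i * M.generator i (0, Status.Down) =
      M.alpha * p (0, Status.Up) - (M.lam + M.beta) * p (0, Status.Down) := by
    rw [Finset.sum_product, Finset.sum_singleton]
    simp only [sum_status, generator, tsum_rate_down]
    simp [rate]
    ring
  rw [← key]
  refine hasSum_sum_of_ne_finset_zero ?_
  rintro ⟨z, t⟩ hz
  have hz' : z ≠ 0 := by simpa [eq_comm] using hz
  simp [generator, rate, hz', hz'.symm]

theorem hasSum_column_succ_down (p : ℕ × Status → ℝ) (x : ℕ) :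
    HasSum (fun i => p i * M.generator i (x + 1, Status.Down))
      (M.lam * p (x, Status.Down) + M.alpha * p (x + 1, Status.Up)
        - (M.lam + M.beta) * p (x + 1, Status.Down)) := by
  have key : ∑ i ∈ ({x, x + 1} : Finset ℕ) ×ˢ Finset.univ,
      p i * M.generator i (x + 1, Status.Down) =
      M.lam * p (x, Status.Down) + M.alpha * p (x + 1, Status.Up)
        - (M.lam + M.beta) * p (x + 1, Status.Down) := by
    rw [Finset.sum_product, Finset.sum_pair (by simp)]
    simp only [sum_status, generator, tsum_rate_down]
    simp [rate]
    ring
  rw [← key]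
  refine hasSum_sum_of_ne_finset_zero ?_
  rintro ⟨z, t⟩ hz
  have hz' : z ≠ x ∧ z ≠ x + 1 := by simpa using hz
  simp [generator, rate, hz'.1.symm, hz'.2, hz'.2.symm]

/-- The unnormalized stationary measure, as a combination of two geometric sequences. -/
def baseMeasure : ℕ × Status → ℝ
  | (k, Status.Up) => M.mu * M.ell * M.γ₁ ^ k + M.tau * (M.mu - M.tau) * M.γ₂ ^ k
  | (k, Status.Down) => (M.mu - M.tau) * M.ell *
      (M.mu / M.tau * M.γ₁ ^ k - M.tau / (M.tau + M.ell) * M.γ₂ ^ k)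

theorem baseMeasure_pos (i : ℕ × Status) : 0 < M.baseMeasure i := by
  have h1 := M.tau_pos
  have h2 := M.ell_half_pos
  have h3 := sub_pos.2 M.tau_lt_mu
  have h4 := M.γ₁_pos
  have h5 := M.γ₂_pos
  have h6 := M.mu_pos
  obtain ⟨k, s⟩ := i
  cases s
  · simp only [baseMeasure]; positivity
  · simp only [baseMeasure]
    refine mul_pos (mul_pos h3 h2) (sub_pos.2 ?_)
    -- The coefficient of γ₁^k exceeds 1 and that of γ₂^k is below 1, so the difference stays
    -- positive.
    have a : M.tau / (M.tau + M.ell) < M.mu / M.tau := by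
      have a1 : M.tau / (M.tau + M.ell) < 1 := by rw [div_lt_one (by positivity)]; linarith
      have a2 : 1 < M.mu / M.tau := by rw [one_lt_div h1]; linarith
      exact a1.trans a2
    have b : M.γ₂ ^ k ≤ M.γ₁ ^ k := pow_le_pow_left₀ h5.le M.γ₂_lt_γ₁.le k
    have c : 0 < M.γ₂ ^ k := by positivity
    calc _ < M.mu / M.tau * M.γ₂ ^ k := mul_lt_mul_of_pos_right a c
      _ ≤ _ := mul_le_mul_of_nonneg_left b (by positivity)

/-- This boundary condition fixes the proportion of the two geometric components; the other two
recurrences hold for each component separately. -/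
theorem baseMeasure_down_zero :
    (M.lam + M.beta) * M.baseMeasure (0, Status.Down) =
      M.alpha * M.baseMeasure (0, Status.Up) := by
  have h1 := M.tau_pos
  have h2 := add_pos M.tau_pos M.ell_half_pos
  simp only [baseMeasure, pow_zero, mul_one]
  rw [M.beta_eq, M.alpha_eq]
  field_simp
  ring

theorem baseMeasure_cut (k : ℕ) :
    M.mu * M.baseMeasure (k + 1, Status.Up) =
      M.lam * (M.baseMeasure (k, Status.Up) + M.baseMeasure (k, Status.Down)) := by
  have h1 := M.tau_pos
  have h2 := add_pos M.tau_pos M.ell_half_pos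
  have h3 := M.mu_pos
  simp only [baseMeasure, pow_succ]
  generalize M.γ₁ ^ k = X
  generalize M.γ₂ ^ k = Y
  rw [γ₁_eq, γ₂]
  field_simp
  ring

theorem baseMeasure_down_succ (k : ℕ) :
    (M.lam + M.beta) * M.baseMeasure (k + 1, Status.Down) =
      M.lam * M.baseMeasure (k, Status.Down) + M.alpha * M.baseMeasure (k + 1, Status.Up) := by
  have h1 := M.tau_pos
  have h2 := add_pos M.tau_pos M.ell_half_pos
  have h3 := M.mu_pos
  simp only [baseMeasure, pow_succ]
  generalize M.γ₁ ^ k = X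
  generalize M.γ₂ ^ k = Y
  rw [M.beta_eq, M.alpha_eq, γ₁_eq, γ₂]
  field_simp
  ring

variable {M} in
theorem IsStationary.down_zero {p : ℕ × Status → ℝ} (hp : M.IsStationary p) :
    (M.lam + M.beta) * p (0, Status.Down) = M.alpha * p (0, Status.Up) := by
  linarith [(hp.balance (0, Status.Down)).unique (M.hasSum_column_zero_down p)]

variable {M} in
theorem IsStationary.down_succ {p : ℕ × Status → ℝ} (hp : M.IsStationary p) (k : ℕ) :
    (M.lam + M.beta) * p (k + 1, Status.Down) =
      M.lam * p (k, Status.Down) + M.alpha * p (k + 1, Status.Up) := by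
  linarith [(hp.balance (k + 1, Status.Down)).unique (M.hasSum_column_succ_down p k)]

variable {M} in
/-- The flow across the cut between levels `k` and `k + 1` is balanced. -/
theorem IsStationary.cut {p : ℕ × Status → ℝ} (hp : M.IsStationary p) (k : ℕ) :
    M.mu * p (k + 1, Status.Up) = M.lam * (p (k, Status.Up) + p (k, Status.Down)) := by
  induction k with
  | zero =>
    have := (hp.balance (0, Status.Up)).unique (M.hasSum_column_zero_up p)
    have := hp.down_zero
    simp only [zero_add]
    linarith
  | succ k ih =>
    -- Adding the Up and Down balances at level k + 1 shows that the net flows across its two cuts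
    -- agree.
    have := (hp.balance (k + 1, Status.Up)).unique (M.hasSum_column_succ_up p k)
    have := hp.down_succ k
    rw [show k + 1 + 1 = k + 2 from rfl]
    linarith

/-- The recurrences satisfied by stationary measures determine them up to a factor. -/
theorem eq_smul_baseMeasure {p : ℕ × Status → ℝ} (hp : M.IsStationary p) :
    p = fun i => p (0, Status.Up) / M.baseMeasure (0, Status.Up) * M.baseMeasure i := by
  have hb := (M.baseMeasure_pos (0, Status.Up)).ne'
  set c := p (0, Status.Up) / M.baseMeasure (0, Status.Up) with hc
  have hlb : M.lam + M.beta ≠ 0 := (add_pos M.lam_pos M.beta_pos).ne'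
  have key : ∀ k, p (k, Status.Up) = c * M.baseMeasure (k, Status.Up) ∧
      p (k, Status.Down) = c * M.baseMeasure (k, Status.Down) := by
    intro k
    induction k with
    | zero =>
      have h0 : p (0, Status.Up) = c * M.baseMeasure (0, Status.Up) := by
        rw [hc, div_mul_cancel₀ _ hb]
      refine ⟨h0, mul_left_cancel₀ hlb ?_⟩
      rw [hp.down_zero, h0]
      linear_combination -c * M.baseMeasure_down_zero
    | succ k ih =>
      have h0 : p (k + 1, Status.Up) = c * M.baseMeasure (k + 1, Status.Up) := by
        refine mul_left_cancel₀ M.mu_pos.ne' ?_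
        rw [hp.cut, ih.1, ih.2]
        linear_combination -c * M.baseMeasure_cut k
      refine ⟨h0, mul_left_cancel₀ hlb ?_⟩
      rw [hp.down_succ, h0, ih.2]
      linear_combination -c * M.baseMeasure_down_succ k
  funext ⟨k, s⟩
  cases s
  · exact (key k).1
  · exact (key k).2

variable {M} in
theorem Stable.summable_baseMeasure (hM : M.Stable) : Summable M.baseMeasure := by
  have h1 := summable_geometric_of_lt_one M.γ₁_pos.le hM.γ₁_lt_one
  have h2 := summable_geometric_of_lt_one M.γ₂_pos.le (M.γ₂_lt_γ₁.trans hM.γ₁_lt_one)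
  -- With the status as outer index, the outer sum is finite and the inner ones are geometric.
  rw [← (Equiv.prodComm Status ℕ).summable_iff]
  refine (summable_prod_of_nonneg fun _ => (M.baseMeasure_pos _).le).2
    ⟨fun s => ?_, (hasSum_fintype _).summable⟩
  cases s
  · exact (h1.mul_left _).add (h2.mul_left _)
  · exact ((h1.mul_left _).sub (h2.mul_left _)).mul_left _

variable {M} in
theorem Stable.existsUnique_isStationary (hM : M.Stable) : ∃! p, M.IsStationary p := by
  have hs := hM.summable_baseMeasure
  have hZ : 0 < ∑' i, M.baseMeasure i :=
    hs.tsum_pos (fun i => (M.baseMeasure_pos i).le) (0, Status.Up) (M.baseMeasure_pos _)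
  set Z := ∑' i, M.baseMeasure i with hZdef
  refine ⟨fun i => Z⁻¹ * M.baseMeasure i, ⟨fun i => ?_, ?_, ?_⟩, fun p hp => ?_⟩
  · have := M.baseMeasure_pos i
    positivity
  · have := hs.hasSum.mul_left Z⁻¹
    rwa [← hZdef, inv_mul_cancel₀ hZ.ne'] at this
  -- The Up balances are recovered from consecutive cut equations and the Down balance.
  · rintro ⟨_ | k, s⟩ <;> cases s
    · convert! M.hasSum_column_zero_up _ using 1
      linear_combination Z⁻¹ * (-M.baseMeasure_cut 0 - M.baseMeasure_down_zero)
    · convert! M.hasSum_column_zero_down _ using 1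
      linear_combination Z⁻¹ * M.baseMeasure_down_zero
    · convert! M.hasSum_column_succ_up _ k using 1
      linear_combination Z⁻¹ * (-M.baseMeasure_cut (k + 1) + M.baseMeasure_cut k
        - M.baseMeasure_down_succ k)
    · convert! M.hasSum_column_succ_down _ k using 1
      linear_combination Z⁻¹ * M.baseMeasure_down_succ k
  · have h1 := M.eq_smul_baseMeasure hp
    set c := p (0, Status.Up) / M.baseMeasure (0, Status.Up)
    have h2 : HasSum p (c * Z) := by
      rw [h1]; exact hs.hasSum.mul_left c
    have h3 : c * Z = 1 := h2.unique hp.total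
    rw [h1, eq_inv_of_mul_eq_one_left h3]

/-! ### One step of the twisted free process -/

/-- The factor of `h` that depends on the status. -/
def weight : Status → ℝ
  | Status.Up => 1
  | Status.Down => M.beta / M.ell

theorem h_eq (x : ℤ) (s : Status) : M.h (x, s) = (M.tau / M.lam) ^ x * M.weight s := by
  cases s
  · rw [h_up, weight, mul_one]
  · rw [h_down, weight]

theorem twisted_eq (C : ℝ) (x y : ℤ) (s t : Status) :
    M.twisted C (x, s) (y, t) =
      M.freeStep C s (y - x) t * (M.tau / M.lam) ^ (y - x) * (M.weight t / M.weight s) := by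
  have h0 : M.tau / M.lam ≠ 0 := (div_pos M.tau_pos M.lam_pos).ne'
  rw [twisted, freeKernel, h_eq, h_eq, zpow_sub₀ h0]
  simp only [div_eq_mul_inv, mul_inv]
  ring

theorem twisted_eq_zero (C : ℝ) {x y : ℤ} (s t : Status)
    (h : y ∉ ({x - 1, x, x + 1} : Finset ℤ)) : M.twisted C (x, s) (y, t) = 0 := by
  have hz' : y ≠ x - 1 ∧ y ≠ x ∧ y ≠ x + 1 := by simpa using h
  have a1 : y - x ≠ 1 := by omega
  have a2 : y - x ≠ -1 := by omega
  have a3 : y - x ≠ 0 := by omega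
  simp [twisted, freeKernel, freeStep, a1, a2, a3]

section values

variable (C : ℝ) (x : ℤ)

/-- Twisting turns the rates λ, μ, α, β into τ, λμ/τ, αβ/ℓ, ℓ and leaves the holding probabilities
unchanged. -/
theorem twisted_up_add_one : M.twisted C (x, Status.Up) (x + 1, Status.Up) = M.tau / C := by
  have := M.lam_pos.ne'
  rw [twisted_eq, add_sub_cancel_left]
  simp [freeStep, weight]
  field_simp

theorem twisted_up_sub_one :
    M.twisted C (x, Status.Up) (x - 1, Status.Up) = M.lam * M.mu / (C * M.tau) := by
  have := M.lam_pos.ne'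
  have := M.tau_pos.ne'
  rw [twisted_eq, sub_sub_cancel_left]
  simp [freeStep, weight]
  field_simp

theorem twisted_up_down :
    M.twisted C (x, Status.Up) (x, Status.Down) = M.alpha * M.beta / (C * M.ell) := by
  rw [twisted_eq, sub_self]
  simp [freeStep, weight]
  field_simp

theorem twisted_up_self :
    M.twisted C (x, Status.Up) (x, Status.Up) = 1 - (M.alpha + M.mu + M.lam) / C := by
  rw [twisted_eq, sub_self]
  simp [freeStep, weight]

theorem twisted_up_add_one_down : M.twisted C (x, Status.Up) (x + 1, Status.Down) = 0 := by
  rw [twisted_eq, add_sub_cancel_left]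
  simp [freeStep]

theorem twisted_up_sub_one_down : M.twisted C (x, Status.Up) (x - 1, Status.Down) = 0 := by
  rw [twisted_eq, sub_sub_cancel_left]
  simp [freeStep]

theorem twisted_down_add_one : M.twisted C (x, Status.Down) (x + 1, Status.Down) = M.tau / C := by
  have := M.lam_pos.ne'
  have := M.beta_pos.ne'
  have := M.ell_half_pos.ne'
  rw [twisted_eq, add_sub_cancel_left]
  simp [freeStep, weight]
  field_simp

theorem twisted_down_up : M.twisted C (x, Status.Down) (x, Status.Up) = M.ell / C := by
  have := M.beta_pos.ne'
  have := M.ell_half_pos.ne'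
  rw [twisted_eq, sub_self]
  simp [freeStep, weight]
  field_simp

theorem twisted_down_self :
    M.twisted C (x, Status.Down) (x, Status.Down) = 1 - (M.lam + M.beta) / C := by
  have := M.beta_pos.ne'
  have := M.ell_half_pos.ne'
  rw [twisted_eq, sub_self]
  simp [freeStep, weight]
  field_simp

theorem twisted_down_add_one_up : M.twisted C (x, Status.Down) (x + 1, Status.Up) = 0 := by
  rw [twisted_eq, add_sub_cancel_left]
  simp [freeStep]

theorem twisted_down_sub_one (t : Status) : M.twisted C (x, Status.Down) (x - 1, t) = 0 := by
  rw [twisted_eq, sub_sub_cancel_left]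
  simp [freeStep]

end values

theorem sum_window {R : Type*} [AddCommMonoid R] (f : ℤ → R) (x : ℤ) :
    ∑ y ∈ ({x - 1, x, x + 1} : Finset ℤ), f y = f (x - 1) + (f x + f (x + 1)) := by
  rw [Finset.sum_insert, Finset.sum_insert, Finset.sum_singleton]
  · simp
  · simp only [Finset.mem_insert, Finset.mem_singleton]; omega

/-- The mean of `F` after one step of the twisted free process. -/
def twistedMean (C : ℝ) (F : ℤ × Status → ℝ) : ℤ × Status → ℝ
  | (x, Status.Up) => M.tau / C * F (x + 1, Status.Up)
      + M.lam * M.mu / (C * M.tau) * F (x - 1, Status.Up)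
      + M.alpha * M.beta / (C * M.ell) * F (x, Status.Down)
      + (1 - (M.alpha + M.mu + M.lam) / C) * F (x, Status.Up)
  | (x, Status.Down) => M.tau / C * F (x + 1, Status.Down)
      + M.ell / C * F (x, Status.Up) + (1 - (M.lam + M.beta) / C) * F (x, Status.Down)

theorem sum_twisted_mul (C : ℝ) (F : ℤ × Status → ℝ) (x : ℤ × Status) :
    ∑ y ∈ ({x.1 - 1, x.1, x.1 + 1} : Finset ℤ) ×ˢ (Finset.univ : Finset Status),
      M.twisted C x y * F y = M.twistedMean C F x := by
  obtain ⟨x, s⟩ := x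
  rw [Finset.sum_product, sum_window]
  simp only [sum_status]
  cases s
  · simp only [twisted_up_add_one, twisted_up_sub_one, twisted_up_down, twisted_up_self,
      twisted_up_add_one_down, twisted_up_sub_one_down, twistedMean]
    ring
  · simp only [twisted_down_add_one, twisted_down_sub_one, twisted_down_up, twisted_down_self,
      twisted_down_add_one_up, twistedMean]
    ring

theorem lintegral_twistedRow {C : ℝ} (hC : M.lam + M.mu + M.alpha + M.beta ≤ C)
    {F : ℤ × Status → ℝ} (hF : ∀ y, 0 ≤ F y) (x : ℤ × Status) :
    ∫⁻ y, ENNReal.ofReal (F y) ∂M.twistedRow C x = ENNReal.ofReal (M.twistedMean C F x) := by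
  rw [twistedRow, lintegral_sum_measure]
  simp only [lintegral_smul_measure, lintegral_dirac, smul_eq_mul]
  rw [tsum_eq_sum (s := {x.1 - 1, x.1, x.1 + 1} ×ˢ Finset.univ), ← sum_twisted_mul,
    ENNReal.ofReal_sum_of_nonneg fun y _ => mul_nonneg (M.twisted_nonneg hC x y) (hF y)]
  · exact Finset.sum_congr rfl fun y _ => (ENNReal.ofReal_mul (M.twisted_nonneg hC x y)).symm
  · rintro ⟨z, t⟩ hz
    obtain ⟨x, s⟩ := x
    rw [M.twisted_eq_zero C s t (by simpa using hz), ENNReal.ofReal_zero, zero_mul]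

theorem twistedMean_nonneg {C : ℝ} (hC : M.lam + M.mu + M.alpha + M.beta ≤ C)
    {F : ℤ × Status → ℝ} (hF : ∀ y, 0 ≤ F y) (x : ℤ × Status) : 0 ≤ M.twistedMean C F x := by
  rw [← sum_twisted_mul]
  exact Finset.sum_nonneg fun y _ => mul_nonneg (M.twisted_nonneg hC x y) (hF y)

/-! ### The drift -/

/-- The unreduced `0 - 1` and `0 + 1` match the one-step values above at `x = 0`. -/
theorem K₂_eq (C : ℝ) (s t : Status) : M.K₂ C s t =
    M.twisted C (0, s) (0 - 1, t) + (M.twisted C (0, s) (0, t) + M.twisted C (0, s) (0 + 1, t)) := by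
  rw [K₂, tsum_eq_sum (s := {0 - 1, 0, 0 + 1}) fun z hz => M.twisted_eq_zero C s t hz, sum_window]

theorem tsum_mul_twisted (C : ℝ) (s t : Status) :
    ∑' z : ℤ, (z : ℝ) * M.twisted C (0, s) (z, t) =
      M.twisted C (0, s) (0 + 1, t) - M.twisted C (0, s) (0 - 1, t) := by
  rw [tsum_eq_sum (s := {0 - 1, 0, 0 + 1})
    fun z hz => by rw [M.twisted_eq_zero C s t hz, mul_zero], sum_window]
  push_cast
  ring

theorem drift_eq {C : ℝ} (hC : 0 < C) :
    M.drift C = 1 / C * (M.tau - 1 / M.G * (M.lam * M.mu) * (M.ell / M.tau)) := by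
  have h1 := M.tau_pos
  have h2 := M.ell_half_pos
  have h3 := M.alpha_pos
  have h4 := M.beta_pos
  have hG : 0 < M.ell ^ 2 + M.alpha * M.beta := by positivity
  simp only [drift, sum_status, φ, K₂_eq, tsum_mul_twisted, twisted_up_add_one,
    twisted_up_sub_one, twisted_up_down, twisted_up_add_one_down, twisted_up_sub_one_down,
    twisted_down_add_one, twisted_down_sub_one, twisted_down_up, twisted_down_add_one_up]
  rw [G_eq]
  -- The normalization of φ, equal to G/C.
  have e : 0 + (M.ell / C + 0) + (0 + (M.alpha * M.beta / (C * M.ell) + 0)) =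
      (M.ell ^ 2 + M.alpha * M.beta) / (C * M.ell) := by
    field_simp
    ring
  have e' : M.ell + M.alpha * M.beta / M.ell = (M.ell ^ 2 + M.alpha * M.beta) / M.ell := by
    field_simp
  rw [e, e']
  field_simp
  ring

/-- In this form τ − λ will cancel against η, and the second factor is `baseMeasure (0, Up)`. -/
theorem drift_eq_factored {C : ℝ} (hC : 0 < C) :
    M.drift C = (M.tau - M.lam) * (M.mu * M.ell + M.tau * (M.mu - M.tau)) /
      (C * M.tau * M.G) := by
  have h1 := M.tau_pos
  have h2 := M.ell_half_pos
  have hG : 0 < M.G := by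
    rw [G_eq]; exact add_pos h2 (div_pos (mul_pos M.alpha_pos M.beta_pos) h2)
  have hG' : M.tau * M.G = M.mu * M.ell + (M.mu - M.tau) * (M.tau - M.lam) := by
    rw [G_eq, M.alpha_eq, M.beta_eq]
    field_simp
    ring
  rw [M.drift_eq hC]
  field_simp
  linear_combination M.tau * hG'

/-! ### Survival of the free and of the twisted free process -/

/-- The mean of `F` after one step of the free process. -/
def freeMean (C : ℝ) (F : ℤ × Status → ℝ) : ℤ × Status → ℝ
  | (x, Status.Up) => M.lam / C * F (x + 1, Status.Up) + M.mu / C * F (x - 1, Status.Up)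
      + M.alpha / C * F (x, Status.Down)
      + (1 - (M.alpha + M.mu + M.lam) / C) * F (x, Status.Up)
  | (x, Status.Down) => M.lam / C * F (x + 1, Status.Down)
      + M.beta / C * F (x, Status.Up) + (1 - (M.lam + M.beta) / C) * F (x, Status.Down)

/-- A step goes down by at most one level, so a comparison valid only on {x ≥ 0} can be used at
every x ≥ 1. -/
theorem freeMean_mono {C : ℝ} (hC : M.lam + M.mu + M.alpha + M.beta ≤ C)
    {F G : ℤ × Status → ℝ} {x : ℤ × Status}
    (hFG : ∀ y, x.1 - 1 ≤ y.1 → F y ≤ G y) : M.freeMean C F x ≤ M.freeMean C G x := by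
  have h1 := M.lam_pos
  have h2 := M.mu_pos
  have h3 := M.alpha_pos
  have h4 := M.beta_pos
  have hC0 : 0 < C := by linarith
  have e1 : 0 ≤ 1 - (M.lam + M.beta) / C := by
    rw [sub_nonneg, div_le_one hC0]; linarith
  have e2 : 0 ≤ 1 - (M.alpha + M.mu + M.lam) / C := by
    rw [sub_nonneg, div_le_one hC0]; linarith
  obtain ⟨x, s⟩ := x
  have k1 : ∀ t, F (x + 1, t) ≤ G (x + 1, t) := fun t => hFG (_, t) (by simp only; omega)
  have k2 : ∀ t, F (x, t) ≤ G (x, t) := fun t => hFG (_, t) (by simp only; omega)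
  have k3 : ∀ t, F (x - 1, t) ≤ G (x - 1, t) := fun t => hFG (_, t) (by simp only; omega)
  cases s
  · simp only [freeMean]
    gcongr <;> first | exact k1 _ | exact k2 _ | exact k3 _
  · simp only [freeMean]
    gcongr <;> first | exact k1 _ | exact k2 _

/-- The probability that the free process stays in `{x ≥ 1}` at the times `0, …, n`. -/
def freeSurvival (C : ℝ) : ℕ → ℤ × Status → ℝ
  | 0, x => if 1 ≤ x.1 then 1 else 0
  | n + 1, x => if 1 ≤ x.1 then M.freeMean C (freeSurvival C n) x else 0

/-- The probability that the twisted free process stays in `{x ≥ 1}` at the times `0, …, n`. -/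
def survival (C : ℝ) : ℕ → ℤ × Status → ℝ
  | 0, x => if 1 ≤ x.1 then 1 else 0
  | n + 1, x => if 1 ≤ x.1 then M.twistedMean C (survival C n) x else 0

theorem freeSurvival_of_le (C : ℝ) (n : ℕ) {x : ℤ × Status} (hx : x.1 ≤ 0) :
    M.freeSurvival C n x = 0 := by
  cases n <;> rw [freeSurvival, if_neg (by omega)]

theorem survival_of_le (C : ℝ) (n : ℕ) {x : ℤ × Status} (hx : x.1 ≤ 0) :
    M.survival C n x = 0 := by
  cases n <;> rw [survival, if_neg (by omega)]

theorem freeSurvival_nonneg {C : ℝ} (hC : M.lam + M.mu + M.alpha + M.beta ≤ C) (n : ℕ)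
    (x : ℤ × Status) : 0 ≤ M.freeSurvival C n x := by
  induction n generalizing x with
  | zero => rw [freeSurvival]; split_ifs <;> norm_num
  | succ n ih =>
    rw [freeSurvival]
    split_ifs
    · refine le_trans (le_of_eq ?_)
        (M.freeMean_mono hC (F := fun _ => 0) (x := x) fun y _ => ih y)
      obtain ⟨x, s⟩ := x
      cases s <;> simp [freeMean]
    · exact le_rfl

theorem survival_nonneg {C : ℝ} (hC : M.lam + M.mu + M.alpha + M.beta ≤ C) (n : ℕ)
    (x : ℤ × Status) : 0 ≤ M.survival C n x := by
  induction n generalizing x with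
  | zero => rw [survival]; split_ifs <;> norm_num
  | succ n ih =>
    rw [survival]
    split_ifs
    · exact M.twistedMean_nonneg hC ih x
    · exact le_rfl

/-- The twisted free process is the `h`-transform of the free process, and `h = 1` where the
latter leaves `{x ≥ 1}`. -/
theorem survival_eq {C : ℝ} (hC : 0 < C) (n : ℕ) {x : ℤ × Status} (hx : 1 ≤ x.1) :
    M.survival C n x = 1 - (1 - M.freeSurvival C n x) / M.h x := by
  have h1 := M.tau_pos
  have h2 := M.ell_half_pos
  have h3 := M.lam_pos
  have h4 := M.beta_pos
  have ht : M.tau / M.lam ≠ 0 := by positivity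
  induction n generalizing x with
  | zero => simp [survival, freeSurvival, hx]
  | succ n ih =>
    rw [survival, freeSurvival, if_pos hx, if_pos hx]
    obtain ⟨x, s⟩ := x
    replace hx : 1 ≤ x := hx
    have hX : 0 < (M.tau / M.lam) ^ x := by positivity
    cases s
    · have k1 := ih (x := (x + 1, Status.Up)) (by simp only; omega)
      have k2 := ih (x := (x, Status.Up)) hx
      have k3 := ih (x := (x, Status.Down)) hx
      -- At x = 1 this is the exit state (0, Up), where h = 1 and the formula still holds. It need
      -- not hold at (0, Down), but no step leads there from {x ≥ 1}.
      have k4 : M.survival C n (x - 1, Status.Up) =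
          1 - (1 - M.freeSurvival C n (x - 1, Status.Up)) / M.h (x - 1, Status.Up) := by
        rcases hx.eq_or_lt with rfl | hx
        · rw [M.freeSurvival_of_le C n (by simp), M.survival_of_le C n (by simp), h_up]
          simp
        · exact ih (by simp only; omega)
      simp only [twistedMean, freeMean, k1, k2, k3, k4]
      rw [h_up, h_up, h_up, h_down, zpow_add_one₀ ht, zpow_sub_one₀ ht]
      generalize M.freeSurvival C n (x + 1, Status.Up) = r1
      generalize M.freeSurvival C n (x - 1, Status.Up) = r2
      generalize M.freeSurvival C n (x, Status.Up) = r3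
      generalize M.freeSurvival C n (x, Status.Down) = r4
      generalize (M.tau / M.lam) ^ x = X at hX
      rw [M.alpha_eq, M.beta_eq]
      have : M.tau + M.ell - M.lam ≠ 0 := by rw [← M.beta_eq]; exact h4.ne'
      field_simp
      ring
    · have k1 := ih (x := (x + 1, Status.Down)) (by simp only; omega)
      have k2 := ih (x := (x, Status.Up)) hx
      have k3 := ih (x := (x, Status.Down)) hx
      simp only [twistedMean, freeMean, k1, k2, k3]
      rw [h_up, h_down, h_down, zpow_add_one₀ ht]
      generalize M.freeSurvival C n (x + 1, Status.Down) = r1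
      generalize M.freeSurvival C n (x, Status.Up) = r3
      generalize M.freeSurvival C n (x, Status.Down) = r4
      generalize (M.tau / M.lam) ^ x = X at hX
      rw [M.beta_eq]
      have : M.tau + M.ell - M.lam ≠ 0 := by rw [← M.beta_eq]; exact h4.ne'
      field_simp
      ring

/-- A linear Lyapunov function of the free process. -/
def lyapunov (x : ℤ × Status) : ℝ :=
  x.1 + match x.2 with
    | Status.Up => 0
    | Status.Down => M.mu / (M.alpha + M.beta)

/-- The bonus μ/(α + β) of the status Down is chosen to make the mean increment the same from both
statuses; it is negative exactly under stability. -/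
theorem freeMean_lyapunov {C : ℝ} (hC : 0 < C) (x : ℤ × Status) :
    M.freeMean C M.lyapunov x =
      M.lyapunov x - (M.mu * M.beta / (M.alpha + M.beta) - M.lam) / C := by
  have h3 := M.alpha_pos
  have h4 := M.beta_pos
  obtain ⟨x, s⟩ := x
  cases s <;>
  · simp only [freeMean, lyapunov]
    push_cast
    field_simp
    ring

theorem lyapunov_nonneg {x : ℤ × Status} (hx : 0 ≤ x.1) : 0 ≤ M.lyapunov x := by
  have h2 := M.mu_pos
  have h3 := M.alpha_pos
  have h4 := M.beta_pos
  have : (0 : ℝ) ≤ x.1 := by exact_mod_cast hx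
  obtain ⟨x, s⟩ := x
  cases s <;> simp only [lyapunov] <;> positivity

theorem freeMean_sum (C : ℝ) (F : ℕ → ℤ × Status → ℝ) (N : ℕ) (x : ℤ × Status) :
    M.freeMean C (fun y => ∑ n ∈ Finset.range N, F n y) x =
      ∑ n ∈ Finset.range N, M.freeMean C (F n) x := by
  obtain ⟨x, s⟩ := x
  cases s <;> simp only [freeMean, Finset.sum_add_distrib, Finset.mul_sum]

variable {M} in
/-- Under the stability condition, the mean exit time of the free process from `{x ≥ 1}` is
finite. -/
theorem Stable.sum_freeSurvival_le (hM : M.Stable) {C : ℝ}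
    (hC : M.lam + M.mu + M.alpha + M.beta ≤ C) (N : ℕ) {x : ℤ × Status} (hx : 0 ≤ x.1) :
    ∑ n ∈ Finset.range N, M.freeSurvival C n x ≤
      C / (M.mu * M.beta / (M.alpha + M.beta) - M.lam) * M.lyapunov x := by
  have h1 := M.lam_pos
  have h2 := M.mu_pos
  have h3 := M.alpha_pos
  have h4 := M.beta_pos
  have hC0 : 0 < C := by linarith
  have hδ : 0 < M.mu * M.beta / (M.alpha + M.beta) - M.lam := by
    rw [sub_pos, lt_div_iff₀ (by positivity)]; exact hM.mul_lt
  set δ := M.mu * M.beta / (M.alpha + M.beta) - M.lam with hδdef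
  have hn : ∀ {x : ℤ × Status}, 0 ≤ x.1 → 0 ≤ C / δ * M.lyapunov x := fun hx =>
    mul_nonneg (by positivity) (M.lyapunov_nonneg hx)
  induction N generalizing x with
  | zero => simpa using hn hx
  | succ N ih =>
    by_cases hx1 : 1 ≤ x.1
    -- The term n = 0 contributes 1, and the first step lowers the scaled Lyapunov function by
    -- exactly 1 on average.
    · rw [Finset.sum_range_succ']
      have e0 : M.freeSurvival C 0 x = 1 := by rw [freeSurvival, if_pos hx1]
      have e1 : ∀ n, M.freeSurvival C (n + 1) x = M.freeMean C (M.freeSurvival C n) x :=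
        fun n => by rw [freeSurvival, if_pos hx1]
      simp only [e0, e1]
      rw [← freeMean_sum]
      have h5 : M.freeMean C (fun y => ∑ n ∈ Finset.range N, M.freeSurvival C n y) x ≤
          M.freeMean C (fun y => C / δ * M.lyapunov y) x :=
        M.freeMean_mono hC fun y hy => ih (by omega)
      have h6 : M.freeMean C (fun y => C / δ * M.lyapunov y) x =
          C / δ * M.freeMean C M.lyapunov x := by
        obtain ⟨x, s⟩ := x
        cases s <;> simp only [freeMean] <;> ring
      rw [h6, M.freeMean_lyapunov hC0, ← hδdef] at h5
      have h7 : C / δ * (M.lyapunov x - δ / C) = C / δ * M.lyapunov x - 1 := by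
        field_simp
      linarith
    · rw [Finset.sum_eq_zero fun n _ => M.freeSurvival_of_le C n (by omega)]
      exact hn hx

variable {M} in
theorem Stable.tendsto_survival (hM : M.Stable) {C : ℝ}
    (hC : M.lam + M.mu + M.alpha + M.beta ≤ C) {x : ℤ × Status} (hx : 1 ≤ x.1) :
    Tendsto (fun n => M.survival C n x) atTop (𝓝 (1 - 1 / M.h x)) := by
  have hC0 : 0 < C := by linarith [M.lam_pos, M.mu_pos, M.alpha_pos, M.beta_pos]
  have h1 : Tendsto (fun n => M.freeSurvival C n x) atTop (𝓝 0) :=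
    (summable_of_sum_range_le (fun n => M.freeSurvival_nonneg hC n x)
      fun N => hM.sum_freeSurvival_le hC N (by omega)).tendsto_atTop_zero
  have h2 := ((h1.const_sub 1).div_const (M.h x)).const_sub 1
  rw [sub_zero] at h2
  exact h2.congr fun n => (M.survival_eq hC0 n hx).symm

/-! ### Escape probabilities -/

/-- The trajectory kernel keeps the prescribed past: its marginal on times up to `a` is the Dirac
mass at `y`. -/
theorem ae_traj_eq {C : ℝ} (a : ℕ) [∀ n, IsMarkovKernel (M.twistedStep C n)]
    (y : (i : Finset.Iic a) → ℤ × Status) :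
    ∀ᵐ ω ∂Kernel.traj (X := fun _ => ℤ × Status) (M.twistedStep C) a y,
      ω a = y ⟨a, Finset.mem_Iic.2 le_rfl⟩ := by
  have h1 := Kernel.traj_map_frestrictLe_apply (X := fun _ => ℤ × Status)
    (κ := M.twistedStep C) a a y
  rw [Kernel.partialTraj_self, Kernel.id_apply] at h1
  have h2 : ∀ᵐ z ∂(Kernel.traj (X := fun _ => ℤ × Status) (M.twistedStep C) a y).map
      (Preorder.frestrictLe a), z = y := by
    rw [h1]; exact (ae_dirac_iff (measurableSet_eq)).2 rfl
  filter_upwards [ae_of_ae_map (by fun_prop) h2] with ω hω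
  rw [← hω]; rfl

/-- The Markov property at time a + 1: average the conditional probability of `S` over one step. -/
theorem traj_survival_succ {C : ℝ} (hC : M.lam + M.mu + M.alpha + M.beta ≤ C)
    [∀ n, IsMarkovKernel (M.twistedStep C n)] {S : Set (ℕ → ℤ × Status)} (hS : MeasurableSet S)
    {F : ℤ × Status → ℝ} (hF : ∀ y, 0 ≤ F y) (a : ℕ)
    (hSF : ∀ z, Kernel.traj (X := fun _ => ℤ × Status) (M.twistedStep C) (a + 1) z S =
      ENNReal.ofReal (F (z ⟨a + 1, Finset.mem_Iic.2 le_rfl⟩)))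
    (y : (i : Finset.Iic a) → ℤ × Status) :
    Kernel.traj (X := fun _ => ℤ × Status) (M.twistedStep C) a y S =
      ENNReal.ofReal (M.twistedMean C F (y ⟨a, Finset.mem_Iic.2 le_rfl⟩)) := by
  rw [← Kernel.traj_comp_partialTraj (X := fun _ => ℤ × Status) (κ := M.twistedStep C) a.le_succ,
    Kernel.comp_apply' _ _ _ hS]
  simp only [hSF]
  rw [← M.lintegral_twistedRow hC hF]
  have h2 : (Kernel.partialTraj (X := fun _ => ℤ × Status) (M.twistedStep C) a (a + 1) y).map
      (fun x => x ⟨a + 1, Finset.mem_Iic.2 le_rfl⟩) =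
      M.twistedRow C (y ⟨a, Finset.mem_Iic.2 le_rfl⟩) := by
    rw [← Kernel.map_apply _ (by fun_prop), Kernel.map_partialTraj_succ_self]
    rfl
  rw [← h2, lintegral_map (measurable_of_countable _) (by fun_prop)]

theorem measurableSet_survive (a n : ℕ) :
    MeasurableSet {ω : ℕ → ℤ × Status | ∀ m ≤ n, 1 ≤ (ω (a + m)).1} := by
  have : {ω : ℕ → ℤ × Status | ∀ m ≤ n, 1 ≤ (ω (a + m)).1} =
      ⋂ m ∈ Set.Iic n, (fun ω : ℕ → ℤ × Status => ω (a + m)) ⁻¹' {x | 1 ≤ x.1} := by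
    ext; simp
  rw [this]
  exact MeasurableSet.biInter (Set.to_countable _) fun m _ =>
    measurable_pi_apply _ (Set.to_countable _).measurableSet

theorem traj_survival {C : ℝ} (hC : M.lam + M.mu + M.alpha + M.beta ≤ C)
    [∀ n, IsMarkovKernel (M.twistedStep C n)] (n a : ℕ)
    (y : (i : Finset.Iic a) → ℤ × Status) :
    Kernel.traj (X := fun _ => ℤ × Status) (M.twistedStep C) a y
        {ω | ∀ m ≤ n, 1 ≤ (ω (a + m)).1} =
      ENNReal.ofReal (M.survival C n (y ⟨a, Finset.mem_Iic.2 le_rfl⟩)) := by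
  -- Conditioning on one more step advances the starting time, so `a` must vary.
  induction n generalizing a with
  | zero =>
    have hae := M.ae_traj_eq (C := C) a y
    by_cases hy : 1 ≤ (y ⟨a, Finset.mem_Iic.2 le_rfl⟩).1
    · rw [survival, if_pos hy, ENNReal.ofReal_one,
        ← prob_compl_eq_zero_iff (measurableSet_survive a 0)]
      refine measure_eq_zero_iff_ae_notMem.2 ?_
      filter_upwards [hae] with ω hω
      simp [hω, hy]
    · rw [survival, if_neg hy, ENNReal.ofReal_zero]
      refine measure_eq_zero_iff_ae_notMem.2 ?_
      filter_upwards [hae] with ω hω h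
      exact hy (hω ▸ h 0 le_rfl)
  | succ n ih =>
    have hae := M.ae_traj_eq (C := C) a y
    by_cases hy : 1 ≤ (y ⟨a, Finset.mem_Iic.2 le_rfl⟩).1
    · rw [survival, if_pos hy, ← M.traj_survival_succ hC (measurableSet_survive (a + 1) n)
        (M.survival_nonneg hC n) a (ih (a + 1)) y]
      refine measure_congr ?_
      filter_upwards [hae] with ω hω
      refine propext ⟨fun h m hm => ?_, fun h m hm => ?_⟩
      · have := h (m + 1) (by omega)
        rwa [show a + (m + 1) = a + 1 + m by omega] at this
      · rcases m with _ | m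
        · rw [add_zero, hω]; exact hy
        · have := h m (by omega)
          rwa [show a + 1 + m = a + (m + 1) by omega] at this
    · rw [survival, if_neg hy, ENNReal.ofReal_zero]
      refine measure_eq_zero_iff_ae_notMem.2 ?_
      filter_upwards [hae] with ω hω h
      exact hy (hω ▸ h 0 (Nat.zero_le _))

/-- Continuity from above. The starting point may lie on the boundary, so survival is required only
from time 1 on, whence the extra averaging over the first step. -/
theorem tendsto_twistedMean_survival {C : ℝ} (hC : M.lam + M.mu + M.alpha + M.beta ≤ C)
    (x : ℤ × Status) : Tendsto (fun n => M.twistedMean C (M.survival C n) x) atTop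
      (𝓝 (M.escape C hC x)) := by
  have := M.twistedStep_markov hC
  set P := M.twistedLaw C hC x with hP
  have hPdef : P = Kernel.traj (X := fun _ => ℤ × Status) (M.twistedStep C) 0 (fun _ => x) := rfl
  have : IsProbabilityMeasure P := by rw [hPdef]; infer_instance
  let S : ℕ → Set (ℕ → ℤ × Status) := fun n => {ω | ∀ m ≤ n, 1 ≤ (ω (1 + m)).1}
  have hval : ∀ n, P (S n) = ENNReal.ofReal (M.twistedMean C (M.survival C n) x) := fun n =>
    M.traj_survival_succ hC (measurableSet_survive 1 n) (M.survival_nonneg hC n) 0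
      (fun z => M.traj_survival hC n 1 z) _
  have hlim : Tendsto (fun n => P (S n)) atTop (𝓝 (P (⋂ n, S n))) :=
    tendsto_measure_iInter_atTop (fun n => (measurableSet_survive 1 n).nullMeasurableSet)
      (fun n m hnm ω hω k hk => hω k (hk.trans hnm)) ⟨0, measure_ne_top _ _⟩
  have hset : (⋂ n, S n) = {ω | ∀ n : ℕ, 1 ≤ n → ω n ∉ (states \ boundary)ᶜ} := by
    ext ω
    have hmem : ∀ n, ω n ∉ (states \ boundary)ᶜ ↔ 1 ≤ (ω n).1 := fun n => by
      simp only [states, boundary, Set.mem_compl_iff, not_not, Set.mem_sdiff, Set.mem_ofPred_eq]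
      omega
    simp only [S, Set.mem_iInter, Set.mem_ofPred_eq, hmem]
    refine ⟨fun h n hn => ?_, fun h n m _ => h _ (by omega)⟩
    have := h n (n - 1) (by omega)
    rwa [show 1 + (n - 1) = n by omega] at this
  rw [escape, ← hset]
  refine ((ENNReal.tendsto_toReal (measure_ne_top P _)).comp hlim).congr fun n => ?_
  rw [Function.comp_apply, hval,
    ENNReal.toReal_ofReal (M.twistedMean_nonneg hC (M.survival_nonneg hC n) x)]

variable {M} in
-- The only step from (0, Up) into {x ≥ 1} leads to (1, Up), with probability τ/C; from there the
-- process survives with probability 1 − λ/τ.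
theorem Stable.escape_up (hM : M.Stable) {C : ℝ} (hC : M.lam + M.mu + M.alpha + M.beta ≤ C) :
    M.escape C hC (0, Status.Up) = (M.tau - M.lam) / C := by
  have h1 := (hM.tendsto_survival hC (x := (0 + 1, Status.Up)) (by simp)).const_mul (M.tau / C)
  have h2 := (M.tendsto_twistedMean_survival hC (0, Status.Up)).congr (f₂ := fun n =>
    M.tau / C * M.survival C n (0 + 1, Status.Up)) fun n => by
      simp only [twistedMean]
      rw [M.survival_of_le C n (x := (0 - 1, _)) (by simp),
        M.survival_of_le C n (x := (0, Status.Down)) (by simp),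
        M.survival_of_le C n (x := (0, Status.Up)) (by simp)]
      ring
  rw [tendsto_nhds_unique h2 h1, h_up]
  have := M.tau_pos
  have := M.lam_pos
  simp
  field_simp

variable {M} in
theorem Stable.escape_down (hM : M.Stable) {C : ℝ} (hC : M.lam + M.mu + M.alpha + M.beta ≤ C) :
    M.escape C hC (0, Status.Down) = (M.tau - M.lam * M.ell / M.beta) / C := by
  have h1 := (hM.tendsto_survival hC (x := (0 + 1, Status.Down)) (by simp)).const_mul (M.tau / C)
  have h2 := (M.tendsto_twistedMean_survival hC (0, Status.Down)).congr (f₂ := fun n =>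
    M.tau / C * M.survival C n (0 + 1, Status.Down)) fun n => by
      simp only [twistedMean]
      rw [M.survival_of_le C n (x := (0, Status.Down)) (by simp),
        M.survival_of_le C n (x := (0, Status.Up)) (by simp)]
      ring
  rw [tendsto_nhds_unique h2 h1, h_down]
  have := M.tau_pos
  have := M.lam_pos
  have := M.beta_pos
  have := M.ell_half_pos
  simp
  field_simp

variable {M} in
theorem Stable.η_eq (hM : M.Stable) {C : ℝ} (hC : M.lam + M.mu + M.alpha + M.beta ≤ C)
    {p : ℕ × Status → ℝ} (hp : M.IsStationary p) :
    M.η C hC p = (M.tau - M.lam) * p (0, Status.Up) * M.mu / (C * M.tau) := by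
  have h1 := M.tau_pos
  have h2 := M.ell_half_pos
  have h3 := M.beta_pos
  have h4 := M.lam_pos
  have hC0 : 0 < C := by linarith [M.mu_pos, M.alpha_pos]
  -- The boundary balance, with λ + β = τ + ℓ, expresses η through p(0, Up) alone.
  have hd : p (0, Status.Down) = M.alpha * p (0, Status.Up) / (M.tau + M.ell) := by
    rw [eq_div_iff (by positivity)]
    linear_combination hp.down_zero - p (0, Status.Down) * M.beta_eq
  have : M.tau + M.ell - M.lam ≠ 0 := by rw [← M.beta_eq]; exact h3.ne'
  rw [η, sum_status, hM.escape_up hC, hM.escape_down hC, h_up, h_down, hd, zpow_zero,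
    M.alpha_eq, M.beta_eq]
  field_simp
  ring

/-! ### The asymptotics -/

variable {M} in
theorem Stable.asympConst_up (hM : M.Stable) {C : ℝ}
    (hC : M.lam + M.mu + M.alpha + M.beta ≤ C) {p : ℕ × Status → ℝ} (hp : M.IsStationary p) :
    M.asympConst C hC p Status.Up =
      p (0, Status.Up) / M.baseMeasure (0, Status.Up) * (M.mu * M.ell) := by
  have h1 := M.tau_pos
  have h2 := M.ell_half_pos
  have h3 := sub_pos.2 hM.lam_lt_tau
  have h4 := M.lam_pos
  have hC0 : 0 < C := by linarith [M.mu_pos, M.alpha_pos, M.beta_pos]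
  have hG : 0 < M.G := by
    rw [G_eq]; exact add_pos h2 (div_pos (mul_pos M.alpha_pos M.beta_pos) h2)
  have h5 : 0 < M.mu * M.ell + M.tau * (M.mu - M.tau) :=
    add_pos (mul_pos M.mu_pos h2) (mul_pos h1 (sub_pos.2 M.tau_lt_mu))
  simp only [asympConst, baseMeasure, pow_zero, mul_one]
  rw [hM.η_eq hC hp, M.drift_eq_factored hC0, two_ell_eq, mul_div_cancel_left₀ _ two_ne_zero]
  field_simp

/-- The ratio α/ℓ = (μ − τ)/τ is also the Down-to-Up ratio in the γ₁ component of `baseMeasure`. -/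
theorem asympConst_down {C : ℝ} (hC : M.lam + M.mu + M.alpha + M.beta ≤ C)
    (p : ℕ × Status → ℝ) :
    M.asympConst C hC p Status.Down =
      M.asympConst C hC p Status.Up * ((M.mu - M.tau) / M.tau) := by
  have h1 := M.tau_pos
  have h2 := M.ell_half_pos
  simp only [asympConst]
  rw [two_ell_eq, mul_div_cancel_left₀ _ two_ne_zero, M.alpha_eq]
  field_simp

/-- Keeping `e` apart from `c` lets the denominator show `asympConst` while the numerator shows its
explicit value. -/
theorem tendsto_geometric_ratio {a b c d e : ℝ} (he : e ≠ 0) (ha : 0 < a) (hb : 0 ≤ b)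
    (hba : b < a) (hec : e = c) :
    Tendsto (fun k : ℕ => (c * a ^ k + d * b ^ k) / (e * a ^ k)) atTop (𝓝 1) := by
  subst hec
  have h1 := ((tendsto_pow_atTop_nhds_zero_of_lt_one (div_nonneg hb ha.le)
    ((div_lt_one ha).2 hba)).const_mul (d / e)).const_add 1
  rw [mul_zero, add_zero] at h1
  refine h1.congr fun k => ?_
  rw [div_pow]
  field_simp

variable {M} in
-- If p(0, Up) vanished, proportionality to `baseMeasure` would make all of p vanish, against total
-- mass 1.
theorem IsStationary.zero_up_pos {p : ℕ × Status → ℝ} (hp : M.IsStationary p) :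
    0 < p (0, Status.Up) := by
  refine (hp.nonneg _).lt_of_ne' fun h0 => ?_
  have h1 := M.eq_smul_baseMeasure hp
  simp only [h0, zero_div, zero_mul] at h1
  have h2 := hp.total
  rw [h1] at h2
  exact zero_ne_one (hasSum_zero.unique h2)

end Model

end UnreliableQueue

end

open UnreliableQueue in
theorem proposition1 (M : Model) (hM : M.Stable)
    (C : ℝ) (hC : M.lam + M.mu + M.alpha + M.beta ≤ C) :
    (∃! π : ℕ × Status → ℝ, M.IsStationary π) ∧
    (0 < M.γ₁ ∧ M.γ₁ < 1) ∧
    M.drift C = 1 / C * ((M.lam + M.beta + M.mu + M.alpha - √M.s₁) / 2 -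
      1 / M.G * (M.lam * M.mu) * ((M.lam + M.beta - M.mu - M.alpha + √M.s₁) /
        (M.lam + M.beta + M.mu + M.alpha - √M.s₁))) ∧
    ∀ π : ℕ × Status → ℝ, M.IsStationary π →
      (M.asympConst C hC π Status.Up ≠ 0 ∧
        Tendsto (fun k : ℕ => π (k, Status.Up) / (M.asympConst C hC π Status.Up * M.γ₁ ^ k))
          atTop (𝓝 1)) ∧
      (M.asympConst C hC π Status.Down ≠ 0 ∧
        Tendsto (fun k : ℕ => π (k, Status.Down) / (M.asympConst C hC π Status.Down * M.γ₁ ^ k))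
          atTop (𝓝 1)) := by
  have hC0 : 0 < C := by linarith [M.lam_pos, M.mu_pos, M.alpha_pos, M.beta_pos]
  refine ⟨hM.existsUnique_isStationary, ⟨M.γ₁_pos, hM.γ₁_lt_one⟩, ?_, fun π hπ => ?_⟩
  · rw [M.denom_eq, M.two_ell_eq, mul_div_mul_left _ _ two_ne_zero,
      mul_div_cancel_left₀ _ two_ne_zero]
    exact M.drift_eq hC0
  · have hu := hM.asympConst_up hC hπ
    have hd := M.asympConst_down hC π
    have hc : 0 < π (0, Status.Up) / M.baseMeasure (0, Status.Up) :=
      div_pos hπ.zero_up_pos (M.baseMeasure_pos _)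
    have hπ' := M.eq_smul_baseMeasure hπ
    generalize π (0, Status.Up) / M.baseMeasure (0, Status.Up) = c at hu hc hπ'
    have hmu := M.mu_pos
    have hell := M.ell_half_pos
    have htau := M.tau_pos
    have hsub := sub_pos.2 M.tau_lt_mu
    have hu0 : 0 < M.asympConst C hC π Status.Up := by rw [hu]; positivity
    have hd0 : 0 < M.asympConst C hC π Status.Down := by rw [hd]; positivity
    rw [hu] at hd
    refine ⟨⟨hu0.ne', ?_⟩, ⟨hd0.ne', ?_⟩⟩
    · refine (Model.tendsto_geometric_ratio (d := c * (M.tau * (M.mu - M.tau))) hu0.ne' M.γ₁_pos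
        M.γ₂_pos.le M.γ₂_lt_γ₁ hu).congr fun k => ?_
      rw [congrFun hπ' (k, Status.Up)]
      simp only [Model.baseMeasure]
      congr 1
      ring
    · refine (Model.tendsto_geometric_ratio
        (d := -(c * ((M.mu - M.tau) * M.ell * (M.tau / (M.tau + M.ell))))) hd0.ne' M.γ₁_pos
        M.γ₂_pos.le M.γ₂_lt_γ₁ hd).congr fun k => ?_
      rw [congrFun hπ' (k, Status.Down)]
      simp only [Model.baseMeasure]
      congr 1
      ring
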